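/- Let $\mathcal H=\bigcup_n X_n$ be the superstructure over $X_0=\mathbb R$, where the reals are individuals (without members) and $X_{n+1}$ is the power set of $X_0\cup X_n$. Let $U$ be an ultrafilter on a set $J$, and let ${}^*\mathcal H$ be the bounded ultrapower of $\mathcal H$ modulo $U$: the $U$-classes $[f]$ of the maps $f\colon J\to\mathcal H$ for which there is an $n$ with $f(j)\in X_0\cup X_n$ for $U$-almost all $j$, with $[f]\in[g]$ iff $f(j)\in g(j)$ for $U$-almost all $j$. The members of ${}^*\mathcal H$ are the internal entities; ${}^*a$ is the class of the constant map $a$, and ${}^\sigma A=\{{}^*a\mid a\in A\}$. An internal set is identified with the set of its members. Assume that ${}^*\mathcal H$ is $\kappa$-saturated for some cardinal $\kappa>|\mathcal H|$: if $\Phi$ is an internal binary relation and $A$ is a nonempty subset of its domain with $|A|<\kappa$, such that for every finite nonempty $T\subseteq A$ there is $b$ with $(a,b)\in\Phi$ for all $a\in T$, then there is an internal $b$ with $(a,b)\in\Phi$ for all $a\in A$. Let $X\in\mathcal H$ be a set. A filter subbase on $X$ is a nonempty collection $\mathcal V\in\mathcal H$ of subsets of $X$ such that the intersection of any finitely many members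 of $\mathcal V$ is nonempty; $\langle\mathcal V\rangle$ is the set of all intersections of finitely many (at least one) members of $\mathcal V$. A filter base on $X$ is a nonempty collection $\mathcal B\in\mathcal H$ of nonempty subsets of $X$ such that for all $A,B\in\mathcal B$ there is $C\in\mathcal B$ with $C\subseteq A\cap B$. The monad is $\mu_{\mathcal V}=\bigcap\{{}^*V\mid V\in\mathcal V\}$. $F(X)$ is the set of all finite subsets of $X$, and the members of ${}^*(F(X))$ are the $*$-finite subsets of ${}^*X$. Then: 1. Let $\mathcal B$ be a filter base on $X$ and $\Lambda\subseteq{}^*\mathcal B$ an internal set such that every $G\in{}^*\mathcal B$ with $G\subseteq\mu_{\mathcal B}$ belongs to $\Lambda$. Then ${}^*B\in\Lambda$ for some $B\in\mathcal B$. 2. Let $\mathcal B$ be a filter base on $X$ and $\Lambda\subseteq{}^*\mathcal B$ an internal set with ${}^\sigma\mathcal B\subseteq\Lambda$. Then there is an internal set $A\in\Lambda$ with $A\subseteq\mu_{\mathcal B}$. 3. Let $\mathcal F$ be a filter subbase on $X$ and $A$ an internal set with $A\cap{}^*F\neq\emptyset$ for every $F\in\langle\mathcal F\rangle$. Then $A\cap\mu_{\mathcal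 F}\neq\emptyset$. If $\mathcal F$ is a filter base on $X$, it is enough that $A\cap{}^*F\neq\emptyset$ for every $F\in\mathcal F$. 4. Let $\mathcal B\subseteq{}^*(F(X))$ be an internal set such that every $E\in{}^*(F(X))$ with ${}^\sigma X\subseteq E\subseteq{}^*X$ belongs to $\mathcal B$. Then ${}^*F\in\mathcal B$ for some $F\in F(X)$. -/

import Mathlib

open Set Filter

universe u

/-! ### The superstructure over a set `S` of individuals -/

/-- `SLevel S n` is `S ∪ X_n`, where `X_{k+1}` is the power set of `S ∪ X_k` (and `X_0 = S`): its
members are the individuals, and, for `n = k + 1`, the sets of members of `SLevel S k`. -/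
def SLevel (S : Type) : ℕ → Type
  | 0 => S
  | n + 1 => S ⊕ Set (SLevel S n)

/-- A set of members of the `n`-th level, as a member of the next level. -/
def SLevel.set {S : Type} {n : ℕ} (s : Set (SLevel S n)) : SLevel S (n + 1) := Sum.inr s

/-- An individual, as a member of the `n`-th level. -/
def SLevel.atom {S : Type} (x : S) : (n : ℕ) → SLevel S n
  | 0 => x
  | _ + 1 => Sum.inl x

theorem SLevel.cases {S : Type} {n : ℕ} (x : SLevel S (n + 1)) :
    (∃ a, x = SLevel.atom a (n + 1)) ∨ ∃ s, x = SLevel.set s := by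
  rcases x with a | s
  · exact Or.inl ⟨a, rfl⟩
  · exact Or.inr ⟨s, rfl⟩

theorem SLevel.set_injective {S : Type} {n : ℕ} :
    Function.Injective (SLevel.set (S := S) (n := n)) := fun _ _ h => Sum.inr.inj h

theorem SLevel.atom_ne_set {S : Type} {n : ℕ} (a : S) (s : Set (SLevel S n)) :
    SLevel.atom a (n + 1) ≠ SLevel.set s := Sum.inl_ne_inr

/-- The inclusion of one level in the next: an individual goes to itself, and a set goes to the
set of the same members. -/
def SLevel.emb (S : Type) : (n : ℕ) → SLevel S n → SLevel S (n + 1)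
  | 0, x => Sum.inl x
  | _ + 1, Sum.inl x => Sum.inl x
  | n + 1, Sum.inr s => Sum.inr (SLevel.emb S n '' s)

theorem SLevel.emb_atom {S : Type} (a : S) :
    ∀ n, SLevel.emb S n (SLevel.atom a n) = SLevel.atom a (n + 1)
  | 0 => rfl
  | _ + 1 => rfl

theorem SLevel.emb_set {S : Type} {n : ℕ} (s : Set (SLevel S n)) :
    SLevel.emb S (n + 1) (SLevel.set s) = SLevel.set (SLevel.emb S n '' s) := rfl

theorem SLevel.emb_injective (S : Type) : ∀ n, Function.Injective (SLevel.emb S n)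
  | 0 => fun _ _ h => Sum.inl.inj h
  | n + 1 => by
    intro x y h
    rcases x.cases with ⟨a, rfl⟩ | ⟨s, rfl⟩ <;> rcases y.cases with ⟨b, rfl⟩ | ⟨t, rfl⟩
    · rw [SLevel.emb_atom, SLevel.emb_atom] at h
      rw [show a = b from Sum.inl.inj h]
    · rw [SLevel.emb_atom, SLevel.emb_set] at h
      exact absurd h (SLevel.atom_ne_set _ _)
    · rw [SLevel.emb_atom, SLevel.emb_set] at h
      exact absurd h.symm (SLevel.atom_ne_set _ _)
    · rw [SLevel.emb_set, SLevel.emb_set] at h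
      rw [(SLevel.emb_injective S n).image_injective (SLevel.set_injective h)]

/-- The inclusion of a level in any later one, by iteration. -/
def SLevel.map (S : Type) (m n : ℕ) (h : m ≤ n) : SLevel S m ↪ SLevel S n where
  toFun := Nat.leRecOn h (fun {k} => SLevel.emb S k)
  inj' := Nat.leRecOn_injective h _ (SLevel.emb_injective S)

theorem SLevel.map_self (S : Type) (n : ℕ) (x : SLevel S n) :
    SLevel.map S n n le_rfl x = x := Nat.leRecOn_self x

theorem SLevel.map_succ (S : Type) {m n : ℕ} (h : m ≤ n) (x : SLevel S m) :
    SLevel.map S m (n + 1) (h.trans (Nat.le_succ n)) x = SLevel.emb S n (SLevel.map S m n h x) :=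
  Nat.leRecOn_succ h x

instance SLevel.directedSystem (S : Type) :
    DirectedSystem (SLevel S) (fun m n h => SLevel.map S m n h) where
  map_self _ x := SLevel.map_self S _ x
  map_map _ _ _ hij hjk x := (Nat.leRecOn_trans hij hjk x).symm

/-- The superstructure over `S`: the union (direct limit along the inclusions) of the levels. -/
def Superstructure (S : Type) : Type := DirectLimit (SLevel S) (SLevel.map S)

namespace Superstructure

variable {S : Type}

/-- A member of the `n`-th level, as a member of the superstructure. -/
def of (n : ℕ) (x : SLevel S n) : Superstructure S :=
  (⟦⟨n, x⟩⟧ : DirectLimit (SLevel S) (SLevel.map S))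

/-- The set of individuals together with the `n`-th level. -/
def level (S : Type) (n : ℕ) : Set (Superstructure S) := range (of n)

/-- The sets among the members of the superstructure, as opposed to the individuals. -/
def IsSet (y : Superstructure S) : Prop :=
  ∃ (n : ℕ) (s : Set (SLevel S n)), y = of (n + 1) (SLevel.set s)

/-- Membership in the superstructure; an individual has no members. -/
instance : Membership (Superstructure S) (Superstructure S) where
  mem y x := ∃ (n : ℕ) (a : SLevel S n) (s : Set (SLevel S n)),
    x = of n a ∧ y = of (n + 1) (SLevel.set s) ∧ a ∈ s

/-- The set of the members of `y`. -/
def elems (y : Superstructure S) : Set (Superstructure S) := {x | x ∈ y}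

theorem of_map {m n : ℕ} (h : m ≤ n) (x : SLevel S m) : of n (SLevel.map S m n h x) = of m x :=
  DirectLimit.mk_apply (f := SLevel.map S) m n x h

theorem of_emb (n : ℕ) (x : SLevel S n) : of (n + 1) (SLevel.emb S n x) = of n x := by
  rw [← of_map (Nat.le_succ n) x, SLevel.map_succ S le_rfl, SLevel.map_self]

theorem of_injective (n : ℕ) : Function.Injective (of (S := S) n) := by
  intro x y h
  obtain ⟨k, hk, hk', e⟩ := Quotient.exact h
  exact (SLevel.map S n k hk).injective e

theorem exists_of (x : Superstructure S) : ∃ n a, x = of n a :=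
  DirectLimit.exists_eq_mk (SLevel.map S) x

theorem level_mono : Monotone (level S) := by
  rintro m n h _ ⟨x, rfl⟩
  exact ⟨_, of_map h x⟩

theorem exists_level (x : Superstructure S) : ∃ n, x ∈ level S n := by
  obtain ⟨n, a, rfl⟩ := exists_of x
  exact ⟨n, a, rfl⟩

theorem of_atom (a : S) (n : ℕ) : of n (SLevel.atom a n) = of 0 (SLevel.atom a 0) := by
  induction n with
  | zero => rfl
  | succ n ih => rw [← SLevel.emb_atom, of_emb, ih]

/-- Raising the level of a set leaves it a set, with the same members. -/
theorem of_set_raise {m n : ℕ} (h : m ≤ n) (s : Set (SLevel S m)) :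
    of (m + 1) (SLevel.set s) = of (n + 1) (SLevel.set (SLevel.map S m n h '' s)) := by
  induction n, h using Nat.le_induction with
  | base =>
    have : (SLevel.map S m m le_rfl : SLevel S m → SLevel S m) = id :=
      funext (SLevel.map_self S m)
    rw [this, image_id]
  | succ n h ih =>
    rw [ih, ← of_emb (n + 1), SLevel.emb_set, image_image]
    congr 2
    exact image_congr fun x _ => (SLevel.map_succ S h x).symm

theorem mem_of_iff {n : ℕ} {a : SLevel S n} {s : Set (SLevel S n)} :
    of n a ∈ of (n + 1) (SLevel.set s) ↔ a ∈ s := by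
  refine ⟨?_, fun h => ⟨n, a, s, rfl, rfl, h⟩⟩
  rintro ⟨m, b, t, hab, hst, hb⟩
  have hm := le_max_left m n
  have hn := le_max_right m n
  rw [of_set_raise hm, of_set_raise hn] at hst
  have hst' := SLevel.set_injective (of_injective _ hst)
  rw [← of_map hm, ← of_map hn] at hab
  have hab' := of_injective _ hab
  have : SLevel.map S n _ hn a ∈ SLevel.map S n _ hn '' s := by
    rw [hst', hab']
    exact ⟨b, hb, rfl⟩
  obtain ⟨c, hc, hca⟩ := this
  exact (SLevel.map S n _ hn).injective hca ▸ hc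

theorem elems_of_set {n : ℕ} (s : Set (SLevel S n)) :
    elems (of (n + 1) (SLevel.set s)) = of n '' s := by
  ext x
  constructor
  · rintro ⟨m, b, t, rfl, hst, hb⟩
    have hm := le_max_left m n
    have hn := le_max_right m n
    rw [of_set_raise hm, of_set_raise hn] at hst
    have hst' := SLevel.set_injective (of_injective _ hst)
    have : SLevel.map S m _ hm b ∈ SLevel.map S n _ hn '' s := hst' ▸ ⟨b, hb, rfl⟩
    obtain ⟨c, hc, hcb⟩ := this
    exact ⟨c, hc, by rw [← of_map hn, hcb, of_map hm]⟩
  · rintro ⟨a, ha, rfl⟩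
    exact mem_of_iff.2 ha

/-- Extensionality. -/
theorem IsSet.ext {x y : Superstructure S} (hx : x.IsSet) (hy : y.IsSet)
    (h : x.elems = y.elems) : x = y := by
  obtain ⟨m, s, rfl⟩ := hx
  obtain ⟨n, t, rfl⟩ := hy
  have hm := le_max_left m n
  have hn := le_max_right m n
  rw [of_set_raise hm, of_set_raise hn] at h ⊢
  rw [elems_of_set, elems_of_set] at h
  rw [(of_injective _).image_injective h]

/-- The members of a set of level `n + 1` are of level `n`. -/
theorem elems_subset_level {n : ℕ} {y : Superstructure S} (hy : y ∈ level S (n + 1)) :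
    y.elems ⊆ level S n := by
  rintro _ ⟨m, b, t, rfl, rfl, hb⟩
  obtain ⟨z, hz⟩ := hy
  have hset : ∃ s, z = SLevel.set s := by
    rcases z.cases with ⟨a, rfl⟩ | hs
    · exfalso
      rw [of_atom, ← of_atom a (m + 1)] at hz
      exact SLevel.atom_ne_set _ _ (of_injective _ hz)
    · exact hs
  obtain ⟨s, rfl⟩ := hset
  have : of m b ∈ (of (n + 1) (SLevel.set s)).elems := by
    rw [hz]
    exact mem_of_iff.2 hb
  rw [elems_of_set] at this
  obtain ⟨c, -, hc⟩ := this
  exact ⟨c, hc⟩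

/-- Every set of members of a fixed level is (the set of members of) a set of the superstructure. -/
theorem exists_set {n : ℕ} {s : Set (Superstructure S)} (hs : s ⊆ level S n) :
    ∃ y : Superstructure S, y ∈ level S (n + 1) ∧ y.IsSet ∧ y.elems = s := by
  refine ⟨of (n + 1) (SLevel.set (of n ⁻¹' s)), ⟨_, rfl⟩, ⟨n, _, rfl⟩, ?_⟩
  rw [elems_of_set, image_preimage_eq_of_subset hs]

/-- The set `s` as a member of the superstructure, for `s` contained in some level. -/
noncomputable def ofSet (s : Set (Superstructure S)) (hs : ∃ n, s ⊆ level S n) :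
    Superstructure S :=
  (exists_set hs.choose_spec).choose

theorem isSet_ofSet (s : Set (Superstructure S)) (hs : ∃ n, s ⊆ level S n) :
    (ofSet s hs).IsSet :=
  (exists_set hs.choose_spec).choose_spec.2.1

theorem elems_ofSet (s : Set (Superstructure S)) (hs : ∃ n, s ⊆ level S n) :
    (ofSet s hs).elems = s :=
  (exists_set hs.choose_spec).choose_spec.2.2

theorem ofSet_mem_level {n : ℕ} {s : Set (Superstructure S)} (hs : s ⊆ level S n) :
    ofSet s ⟨n, hs⟩ ∈ level S (n + 1) := by
  obtain ⟨y, hy, hset, hel⟩ := exists_set hs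
  rwa [(isSet_ofSet s ⟨n, hs⟩).ext hset ((elems_ofSet s ⟨n, hs⟩).trans hel.symm)]

theorem pair_subset_level {n : ℕ} {a b : Superstructure S} (ha : a ∈ level S n)
    (hb : b ∈ level S n) : ({a, b} : Set (Superstructure S)) ⊆ level S n := by
  rintro x (rfl | rfl)
  · exact ha
  · exact hb

theorem exists_pair_subset_level (a b : Superstructure S) :
    ∃ n, ({a, b} : Set (Superstructure S)) ⊆ level S n := by
  obtain ⟨m, hm⟩ := exists_level a
  obtain ⟨n, hn⟩ := exists_level b
  exact ⟨max m n, pair_subset_level (level_mono (le_max_left m n) hm)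
    (level_mono (le_max_right m n) hn)⟩

/-- The unordered pair `{a, b}`. -/
noncomputable def upair (a b : Superstructure S) : Superstructure S :=
  ofSet {a, b} (exists_pair_subset_level a b)

/-- The (Kuratowski) ordered pair `(a, b) = {{a}, {a, b}}`. -/
noncomputable def pair (a b : Superstructure S) : Superstructure S :=
  upair (upair a a) (upair a b)

theorem upair_mem_level {n : ℕ} {a b : Superstructure S} (ha : a ∈ level S n)
    (hb : b ∈ level S n) : upair a b ∈ level S (n + 1) :=
  ofSet_mem_level (pair_subset_level ha hb)

theorem pair_mem_level {n : ℕ} {a b : Superstructure S} (ha : a ∈ level S n)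
    (hb : b ∈ level S n) : pair a b ∈ level S (n + 2) :=
  upair_mem_level (upair_mem_level ha ha) (upair_mem_level ha hb)

/-- `E` is a subset of `X`. -/
def IsSubset (E X : Superstructure S) : Prop := E.IsSet ∧ E.elems ⊆ X.elems

theorem exists_finiteSubsets_subset_level (X : Superstructure S) :
    ∃ n, {E : Superstructure S | E.IsSubset X ∧ E.elems.Finite} ⊆ level S n := by
  obtain ⟨n, hn⟩ := exists_level X
  refine ⟨n + 1, fun E hE => ?_⟩
  obtain ⟨y, hy, hset, hel⟩ := exists_set
    (hE.1.2.trans (elems_subset_level (level_mono (Nat.le_succ n) hn)))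
  rwa [hE.1.1.ext hset hel.symm]

/-- `F(X)`, the set of all finite subsets of `X`. -/
noncomputable def finiteSubsets (X : Superstructure S) : Superstructure S :=
  ofSet {E | E.IsSubset X ∧ E.elems.Finite} (exists_finiteSubsets_subset_level X)

/-! ### Filter subbases and filter bases in the superstructure -/

/-- `𝓥` is a filter subbase on the set `X`: a nonempty collection of subsets of `X` such that the
intersection of any finitely many members is nonempty (in particular `∅ ∉ 𝓥`). -/
structure IsFilterSubbase (X 𝓥 : Superstructure S) : Prop where
  isSet_base : X.IsSet
  isSet : 𝓥.IsSet
  nonempty : 𝓥.elems.Nonempty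
  subset : ∀ V ∈ 𝓥, V.IsSubset X
  finite_inter : ∀ T : Set (Superstructure S), T.Finite → T.Nonempty → T ⊆ 𝓥.elems →
    (⋂ V ∈ T, V.elems).Nonempty

/-- `𝓑` is a filter base on the set `X`. -/
structure IsFilterBase (X 𝓑 : Superstructure S) : Prop where
  isSet_base : X.IsSet
  isSet : 𝓑.IsSet
  nonempty : 𝓑.elems.Nonempty
  subset : ∀ B ∈ 𝓑, B.IsSubset X
  nonempty_of_mem : ∀ B ∈ 𝓑, B.elems.Nonempty
  inter : ∀ A ∈ 𝓑, ∀ B ∈ 𝓑, ∃ C ∈ 𝓑, C.elems ⊆ A.elems ∩ B.elems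

/-- `V` is the intersection of finitely many (at least one) members of `𝓥`, that is,
`V ∈ ⟨𝓥⟩`. -/
def IsFiniteInter (𝓥 V : Superstructure S) : Prop :=
  V.IsSet ∧ ∃ T : Set (Superstructure S), T.Finite ∧ T.Nonempty ∧ T ⊆ 𝓥.elems ∧
    V.elems = ⋂ W ∈ T, W.elems

end Superstructure

/-! ### The bounded ultrapower of the superstructure -/

/-- The bounded ultrapower of the superstructure over `S` modulo the ultrafilter `U`: the
`U`-equivalence classes of the maps `f : J → Superstructure S` such that, for some `n`, `f j` is of
level `n` for `U`-almost all `j`. Its members are the internal entities. -/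
def BoundedUltrapower (S : Type) {J : Type u} (U : Ultrafilter J) : Type u :=
  {f : Germ (U : Filter J) (Superstructure S) // ∃ n, f.LiftPred (· ∈ Superstructure.level S n)}

namespace BoundedUltrapower

variable {S : Type} {J : Type u} {U : Ultrafilter J}

/-- Membership in the ultrapower: `[f] ∈ [g]` iff `f j ∈ g j` for `U`-almost all `j`. -/
instance : Membership (BoundedUltrapower S U) (BoundedUltrapower S U) where
  mem b a := a.1.LiftRel (fun x y : Superstructure S => x ∈ y) b.1

/-- The set (in general external) of the members of `b`. -/
def elems (b : BoundedUltrapower S U) : Set (BoundedUltrapower S U) := {a | a ∈ b}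

/-- The internal sets, as opposed to the members of `*S`: the classes `[f]` with `f j` a set for
`U`-almost all `j`. -/
def IsSet (b : BoundedUltrapower S U) : Prop := b.1.LiftPred Superstructure.IsSet

/-- `*a`, the class of the constant map `a`. -/
def star (U : Ultrafilter J) (a : Superstructure S) : BoundedUltrapower S U :=
  ⟨(a : Germ (U : Filter J) (Superstructure S)), by
    obtain ⟨n, hn⟩ := Superstructure.exists_level a
    exact ⟨n, Germ.liftPred_const hn⟩⟩

/-- `σA = {*a | a ∈ A}`, the standard copy of `A`. -/
def sigma (U : Ultrafilter J) (A : Superstructure S) : Set (BoundedUltrapower S U) :=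
  star U '' A.elems

/-- The internal ordered pair, formed pointwise. -/
noncomputable def pair (a b : BoundedUltrapower S U) : BoundedUltrapower S U :=
  ⟨Germ.map₂ Superstructure.pair a.1 b.1, by
    obtain ⟨⟨f⟩, m, hf⟩ := a
    obtain ⟨⟨g⟩, n, hg⟩ := b
    refine ⟨max m n + 2, ?_⟩
    have hf' : ∀ᶠ j in (U : Filter J), f j ∈ Superstructure.level S m := hf
    have hg' : ∀ᶠ j in (U : Filter J), g j ∈ Superstructure.level S n := hg
    change ∀ᶠ j in (U : Filter J), Superstructure.pair (f j) (g j) ∈ _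
    filter_upwards [hf', hg'] with j h1 h2
    exact Superstructure.pair_mem_level (Superstructure.level_mono (le_max_left m n) h1)
      (Superstructure.level_mono (le_max_right m n) h2)⟩

/-- An internal binary relation: an internal set of ordered pairs. -/
def IsRelation (Φ : BoundedUltrapower S U) : Prop := Φ.IsSet ∧ ∀ p ∈ Φ, ∃ a b, p = pair a b

/-- The domain of an internal binary relation. -/
def domain (Φ : BoundedUltrapower S U) : Set (BoundedUltrapower S U) := {a | ∃ b, pair a b ∈ Φ}

/-- `Φ` is concurrent on `A`: any finitely many members of `A` are related by `Φ` to one and the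
same `b`. -/
def ConcurrentOn (Φ : BoundedUltrapower S U) (A : Set (BoundedUltrapower S U)) : Prop :=
  ∀ T : Set (BoundedUltrapower S U), T.Finite → T.Nonempty → T ⊆ A → ∃ b, ∀ a ∈ T, pair a b ∈ Φ

/-- The bounded ultrapower is `κ`-saturated: whenever an internal binary relation `Φ` is
concurrent on a nonempty subset `A` of its domain, of cardinality less than `κ`, there is an
internal `b` to which all the members of `A` are related by `Φ`. -/
def IsSaturated (S : Type) (U : Ultrafilter J) (κ : Cardinal.{u}) : Prop :=
  ∀ Φ : BoundedUltrapower S U, Φ.IsRelation → ∀ A : Set (BoundedUltrapower S U), A.Nonempty →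
    A ⊆ Φ.domain → Cardinal.mk A < κ → Φ.ConcurrentOn A → ∃ b, ∀ a ∈ A, pair a b ∈ Φ

/-- The monad `μ_𝓥 = ⋂ {*V | V ∈ 𝓥}`. -/
def monad (U : Ultrafilter J) (𝓥 : Superstructure S) : Set (BoundedUltrapower S U) :=
  ⋂ V ∈ 𝓥.elems, (star U V).elems

end BoundedUltrapower

/-! Each conclusion asks for one internal entity satisfying a condition for every member of a
standard set `A`. Since `|σA| ≤ |A| ≤ |𝓗| < κ`, saturation reduces this to satisfying finitely many
conditions at once. `IsSaturated.exists_forall_eventually` does the translation: a family of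
relations `R j`, with second argument in a fixed level, is encoded by its graphs as an internal
relation, to which saturation applies. For `Λ ⊇ σ𝓑`, the conditions are `y ∈ Λ` and `y ⊆ *B`;
finitely many hold for `*C`, where `C ∈ 𝓑` lies below the given sets `B`. The first assertion
follows from this one applied to the internal complement `*𝓑 \ Λ`. For the monad, the conditions are
`y ∈ A` and `y ∈ *F`, met by a point of `A` in `*F'` with `F'` below the finitely many `F`. For
`*`-finite sets, if no `*F` were in the given set, saturation would give a `*`-finite set outside it
that contains `σX`. -/

namespace Superstructure

variable {S : Type}

/-! ### Pairs, finite subsets and finite intersections in the superstructure -/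

theorem elems_upair (a b : Superstructure S) : (upair a b).elems = {a, b} :=
  elems_ofSet _ _

theorem mem_ofSet {s : Set (Superstructure S)} {hs : ∃ n, s ⊆ level S n}
    {x : Superstructure S} : x ∈ ofSet s hs ↔ x ∈ s :=
  Set.ext_iff.1 (elems_ofSet s hs) x

theorem pair_inj {a b c d : Superstructure S} (h : pair a b = pair c d) : a = c ∧ b = d := by
  have key : ∀ {x y z w : Superstructure S}, upair x y = upair z w →
      (x = z ∧ y = w) ∨ (x = w ∧ y = z) := fun {x y z w} h => by
    have h' := congrArg elems h
    rw [elems_upair, elems_upair] at h'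
    exact Set.pair_eq_pair_iff.1 h'
  rcases key h with ⟨h1, h2⟩ | ⟨h1, h2⟩ <;> rcases key h1 with ⟨h3, h4⟩ | ⟨h3, h4⟩ <;>
    rcases key h2 with ⟨h5, h6⟩ | ⟨h5, h6⟩ <;> grind

theorem exists_elems_subset_level (X : Superstructure S) : ∃ n, X.elems ⊆ level S n := by
  obtain ⟨n, hn⟩ := exists_level X
  exact ⟨n, elems_subset_level (level_mono (Nat.le_succ n) hn)⟩

theorem mem_finiteSubsets {X E : Superstructure S} :
    E ∈ X.finiteSubsets ↔ E.IsSubset X ∧ E.elems.Finite :=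
  mem_ofSet

theorem exists_finiteSubsets_elems_eq {X : Superstructure S} {T : Set (Superstructure S)}
    (hT : T.Finite) (hTX : T ⊆ X.elems) : ∃ F ∈ X.finiteSubsets, F.elems = T := by
  obtain ⟨n, hn⟩ := X.exists_elems_subset_level
  obtain ⟨F, -, hF, rfl⟩ := exists_set (hTX.trans hn)
  exact ⟨F, mem_finiteSubsets.2 ⟨⟨hF, hTX⟩, hT⟩, rfl⟩

/-- A filter base is downward directed over its finite subcollections. -/
theorem IsFilterBase.exists_subset_of_finite {X 𝓑 : Superstructure S} (h : X.IsFilterBase 𝓑)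
    {T : Set (Superstructure S)} (hT : T.Finite) (hT𝓑 : T ⊆ 𝓑.elems) :
    ∃ C ∈ 𝓑, ∀ B ∈ T, C.elems ⊆ B.elems := by
  induction T, hT using Set.Finite.induction_on with
  | empty =>
    obtain ⟨C, hC⟩ := h.nonempty
    exact ⟨C, hC, by simp⟩
  | @insert B T _ _ ih =>
    obtain ⟨C, hC, hCT⟩ := ih ((subset_insert B T).trans hT𝓑)
    obtain ⟨D, hD, hDBC⟩ := h.inter B (hT𝓑 (mem_insert B T)) C hC
    refine ⟨D, hD, ?_⟩
    rintro A (rfl | hA)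
    · exact hDBC.trans inter_subset_left
    · exact (hDBC.trans inter_subset_right).trans (hCT A hA)

/-- A finite intersection of members of `𝓥` is the set of members of some element of `⟨𝓥⟩`. -/
theorem exists_isFiniteInter {𝓥 : Superstructure S} {T : Set (Superstructure S)}
    (hT : T.Finite) (hne : T.Nonempty) (hT𝓥 : T ⊆ 𝓥.elems) :
    ∃ F, 𝓥.IsFiniteInter F ∧ F.elems = ⋂ W ∈ T, W.elems := by
  obtain ⟨W, hW⟩ := hne
  -- Only sets bounded in level are entities; one member `W` of `T` bounds the intersection, which
  -- is why `T` must be nonempty.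
  obtain ⟨n, hn⟩ := W.exists_elems_subset_level
  obtain ⟨F, -, hF, hFT⟩ := exists_set ((biInter_subset_of_mem (t := elems) hW).trans hn)
  exact ⟨F, ⟨hF, T, hT, ⟨W, hW⟩, hT𝓥, hFT⟩, hFT⟩

end Superstructure

namespace BoundedUltrapower

open Superstructure (level)

variable {S : Type} {J : Type u} {U : Ultrafilter J}

/-! ### Representatives of internal entities -/

/-- The internal entity represented by an almost everywhere bounded map. -/
def mk (U : Ultrafilter J) (f : J → Superstructure S)
    (hf : ∃ n, ∀ᶠ j in (U : Filter J), f j ∈ level S n) : BoundedUltrapower S U :=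
  ⟨(f : Germ (U : Filter J) (Superstructure S)), hf⟩

theorem exists_mk (a : BoundedUltrapower S U) : ∃ f hf, a = mk U f hf := by
  obtain ⟨⟨f⟩, hf⟩ := a
  exact ⟨f, hf, rfl⟩

theorem mem_elems {a b : BoundedUltrapower S U} : a ∈ b.elems ↔ a ∈ b := Iff.rfl

theorem mk_mem_mk {f g : J → Superstructure S} {hf hg} :
    mk U f hf ∈ mk U g hg ↔ ∀ᶠ j in (U : Filter J), f j ∈ g j := Iff.rfl

theorem mk_mem_star {f : J → Superstructure S} {hf} {A : Superstructure S} :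
    mk U f hf ∈ star U A ↔ ∀ᶠ j in (U : Filter J), f j ∈ A := Iff.rfl

theorem star_mem_mk {f : J → Superstructure S} {hf} {a : Superstructure S} :
    star U a ∈ mk U f hf ↔ ∀ᶠ j in (U : Filter J), a ∈ f j := Iff.rfl

theorem star_mem_star {a A : Superstructure S} (h : a ∈ A) : star U a ∈ star U A :=
  Eventually.of_forall fun _ => h

theorem mem_monad {𝓥 : Superstructure S} {x : BoundedUltrapower S U} :
    x ∈ monad U 𝓥 ↔ ∀ V ∈ 𝓥, x ∈ star U V := by
  simp only [monad, mem_iInter]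
  rfl

/-- Pointwise inclusion almost everywhere gives inclusion of internal sets. -/
theorem elems_mk_subset {f g : J → Superstructure S} {hf hg}
    (h : ∀ᶠ j in (U : Filter J), (f j).elems ⊆ (g j).elems) :
    (mk U f hf).elems ⊆ (mk U g hg).elems := by
  intro x hx
  obtain ⟨e, he, rfl⟩ := exists_mk x
  filter_upwards [h, mk_mem_mk.1 (mem_elems.1 hx)] with j h1 h2 using h1 h2

/-! ### Saturation for pointwise relations -/

/-- The form of saturation for families of relations indexed by `J`, between the members of a
standard set and the entities of a fixed level. -/
theorem IsSaturated.exists_forall_eventually {κ : Cardinal.{u}} (hsat : IsSaturated S U κ)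
    (hκ : Cardinal.lift.{u} (Cardinal.mk (Superstructure S)) < κ) {A : Superstructure S}
    (hA : A.elems.Nonempty) (n : ℕ) (R : J → Superstructure S → Superstructure S → Prop)
    (hR : ∀ T : Set (Superstructure S), T.Finite → T.Nonempty → T ⊆ A.elems →
      ∃ f : J → Superstructure S, ∀ a ∈ T, ∀ᶠ j in (U : Filter J), f j ∈ level S n ∧ R j a (f j)) :
    ∃ f : J → Superstructure S, (∃ m, ∀ᶠ j in (U : Filter J), f j ∈ level S m) ∧
      ∀ a ∈ A, ∀ᶠ j in (U : Filter J), R j a (f j) := by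
  obtain ⟨m, hm⟩ := A.exists_elems_subset_level
  -- The graph of `R j` on `A × level S n`. Bounding the second coordinate keeps all the graphs in
  -- one level, so that they define an internal set.
  let s : J → Set (Superstructure S) := fun j =>
    {p | ∃ a ∈ A, ∃ y ∈ level S n, R j a y ∧ p = Superstructure.pair a y}
  have hs : ∀ j, s j ⊆ level S (max m n + 2) := by
    rintro j _ ⟨a, ha, y, hy, -, rfl⟩
    exact Superstructure.pair_mem_level (Superstructure.level_mono (le_max_left m n) (hm ha))
      (Superstructure.level_mono (le_max_right m n) hy)
  let Φ : BoundedUltrapower S U := mk U (fun j => Superstructure.ofSet (s j) ⟨_, hs j⟩)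
    ⟨_, Eventually.of_forall fun j => Superstructure.ofSet_mem_level (hs j)⟩
  have mem_Φ : ∀ a ∈ A, ∀ f hf, pair (star U a) (mk U f hf) ∈ Φ ↔
      ∀ᶠ j in (U : Filter J), f j ∈ level S n ∧ R j a (f j) := by
    intro a ha f hf
    change (∀ᶠ j in (U : Filter J), Superstructure.pair a (f j) ∈
      Superstructure.ofSet (s j) ⟨_, hs j⟩) ↔ _
    refine eventually_congr (Eventually.of_forall fun j => Superstructure.mem_ofSet.trans ?_)
    constructor
    · rintro ⟨b, -, y, hy, hR, h⟩
      obtain ⟨rfl, rfl⟩ := Superstructure.pair_inj h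
      exact ⟨hy, hR⟩
    · rintro ⟨hy, hR⟩
      exact ⟨a, ha, _, hy, hR, rfl⟩
  have hΦ : Φ.IsRelation := by
    refine ⟨Eventually.of_forall fun j => Superstructure.isSet_ofSet _ _, fun p hp => ?_⟩
    obtain ⟨f, hf, rfl⟩ := exists_mk p
    have hp' : ∀ᶠ j in (U : Filter J), f j ∈ s j := by
      filter_upwards [mk_mem_mk.1 hp] with j hj using Superstructure.mem_ofSet.1 hj
    -- `choose!` needs a default value at the negligible set of `j` with `f j ∉ s j`.
    have : Nonempty (Superstructure S) := ⟨A⟩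
    choose! g hg y hy _ hgy using fun j (h : f j ∈ s j) => h
    refine ⟨mk U g ⟨m, hp'.mono fun j h => hm (hg j h)⟩, mk U y ⟨n, hp'.mono hy⟩, ?_⟩
    exact Subtype.ext (Germ.coe_eq.2 (hp'.mono hgy))
  have hconc : Φ.ConcurrentOn (sigma U A) := by
    intro T hT hne hTA
    -- A finite subset of `σA` is the image of a finite subset of `A`, to which `hR` applies.
    obtain ⟨T, hTA', hTfin, rfl⟩ := exists_subset_image_finite_and.1 ⟨T, hTA, hT, rfl⟩
    obtain ⟨f, hf⟩ := hR T hTfin hne.of_image hTA'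
    obtain ⟨a, ha⟩ := hne.of_image
    refine ⟨mk U f ⟨n, (hf a ha).mono fun _ h => h.1⟩, ?_⟩
    rintro _ ⟨a, ha, rfl⟩
    exact (mem_Φ a (hTA' ha) _ _).2 (hf a ha)
  have hdom : sigma U A ⊆ Φ.domain := by
    intro a ha
    obtain ⟨b, hb⟩ := hconc {a} (finite_singleton a) (singleton_nonempty a)
      (singleton_subset_iff.2 ha)
    exact ⟨b, hb a rfl⟩
  have hcard : Cardinal.mk (sigma U A) < κ := by
    refine lt_of_le_of_lt ?_ hκ
    have h := Cardinal.mk_image_le_lift (f := star U) (s := A.elems)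
    simp only [Cardinal.lift_uzero] at h
    exact h.trans (Cardinal.lift_le.2 (Cardinal.mk_set_le _))
  obtain ⟨b, hb⟩ := hsat Φ hΦ _ (hA.image _) hdom hcard hconc
  obtain ⟨f, hf, rfl⟩ := exists_mk b
  exact ⟨f, hf, fun a ha =>
    ((mem_Φ a ha f hf).1 (hb _ (mem_image_of_mem _ ha))).mono fun _ h => h.2⟩

/-! ### The assertions on filter bases, monads and `*`-finite sets -/

/-- An internal set of members of `*𝓑` containing the standard members of the filter base `𝓑` has
a member contained in the monad. -/
theorem exists_mem_subset_monad {κ : Cardinal.{u}} (hsat : IsSaturated S U κ)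
    (hκ : Cardinal.lift.{u} (Cardinal.mk (Superstructure S)) < κ) {X 𝓑 : Superstructure S}
    (h𝓑 : X.IsFilterBase 𝓑) {Λ : BoundedUltrapower S U} (hΛ : Λ.elems ⊆ (star U 𝓑).elems)
    (hσ : sigma U 𝓑 ⊆ Λ.elems) : ∃ A ∈ Λ, A.IsSet ∧ A.elems ⊆ monad U 𝓑 := by
  obtain ⟨g, hg, rfl⟩ := exists_mk Λ
  obtain ⟨n, hn⟩ := 𝓑.exists_elems_subset_level
  obtain ⟨f, hf, hfR⟩ := hsat.exists_forall_eventually hκ h𝓑.nonempty n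
    (fun j B y => y ∈ g j ∧ y.elems ⊆ B.elems) (by
      intro T hT _ hT𝓑
      obtain ⟨C, hC, hCT⟩ := h𝓑.exists_subset_of_finite hT hT𝓑
      -- The constant map works because `*C ∈ σ𝓑 ⊆ Λ`.
      refine ⟨fun _ => C, fun B hB => ?_⟩
      filter_upwards [star_mem_mk.1 (mem_elems.1 (hσ (mem_image_of_mem _ hC)))] with j hj
      exact ⟨hn hC, hj, hCT B hB⟩)
  obtain ⟨B, hB⟩ := h𝓑.nonempty
  have hfΛ : mk U f hf ∈ mk U g hg := (hfR B hB).mono fun _ h => h.1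
  refine ⟨mk U f hf, hfΛ, ?_, fun x hx => mem_monad.2 fun V hV => ?_⟩
  · have hf𝓑 : mk U f hf ∈ star U 𝓑 := mem_elems.1 (hΛ (mem_elems.2 hfΛ))
    exact (mk_mem_star.1 hf𝓑).mono fun j h => (h𝓑.subset _ h).1
  · exact elems_mk_subset (hg := ⟨_, (star U V).2.choose_spec⟩)
      ((hfR V hV).mono fun _ h => h.2) hx

/-- An internal set containing all members of `*𝓑` inside the monad contains a standard one. -/
theorem exists_star_mem_of_forall_subset_monad {κ : Cardinal.{u}} (hsat : IsSaturated S U κ)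
    (hκ : Cardinal.lift.{u} (Cardinal.mk (Superstructure S)) < κ) {X 𝓑 : Superstructure S}
    (h𝓑 : X.IsFilterBase 𝓑) {Λ : BoundedUltrapower S U}
    (h : ∀ G ∈ star U 𝓑, G.elems ⊆ monad U 𝓑 → G ∈ Λ) : ∃ B ∈ 𝓑, star U B ∈ Λ := by
  by_contra! hcon
  obtain ⟨g, hg, rfl⟩ := exists_mk Λ
  obtain ⟨n, hn⟩ := 𝓑.exists_elems_subset_level
  have hs : ∀ j, 𝓑.elems \ (g j).elems ⊆ level S n := fun j => sdiff_subset.trans hn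
  -- The internal complement `*𝓑 \ Λ`, formed pointwise. By `hcon` it contains `σ𝓑`, so it has a
  -- member inside the monad, which `h` puts in `Λ`.
  let Λ' : BoundedUltrapower S U := mk U (fun j => Superstructure.ofSet _ ⟨_, hs j⟩)
    ⟨_, Eventually.of_forall fun j => Superstructure.ofSet_mem_level (hs j)⟩
  have mem_Λ' : ∀ x, x ∈ Λ' ↔ x ∈ star U 𝓑 ∧ x ∉ mk U g hg := by
    intro x
    obtain ⟨f, hf, rfl⟩ := exists_mk x
    -- The ultrafilter property turns failure of membership in `Λ` into pointwise failure almost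
    -- everywhere.
    rw [mk_mem_mk, mk_mem_star, mk_mem_mk, ← Ultrafilter.eventually_not, ← eventually_and]
    exact eventually_congr (Eventually.of_forall fun j => Superstructure.mem_ofSet)
  obtain ⟨A, hA, -, hAμ⟩ := exists_mem_subset_monad hsat hκ h𝓑 (Λ := Λ')
    (fun x hx => ((mem_Λ' x).1 hx).1) (by
      rintro _ ⟨B, hB, rfl⟩
      exact (mem_Λ' _).2 ⟨star_mem_star hB, hcon B hB⟩)
  obtain ⟨hA𝓑, hAΛ⟩ := (mem_Λ' A).1 hA
  exact hAΛ (h A hA𝓑 hAμ)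

/-- An internal set meeting `*F` for a set `F` below each finite subcollection of `𝓕` meets the
monad of `𝓕`. -/
theorem inter_monad_nonempty {κ : Cardinal.{u}} (hsat : IsSaturated S U κ)
    (hκ : Cardinal.lift.{u} (Cardinal.mk (Superstructure S)) < κ) {𝓕 : Superstructure S}
    (h𝓕 : 𝓕.elems.Nonempty) {A : BoundedUltrapower S U}
    (h : ∀ T : Set (Superstructure S), T.Finite → T.Nonempty → T ⊆ 𝓕.elems →
      ∃ F : Superstructure S, (∀ W ∈ T, F.elems ⊆ W.elems) ∧
        (A.elems ∩ (star U F).elems).Nonempty) :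
    (A.elems ∩ monad U 𝓕).Nonempty := by
  obtain ⟨g, hg, rfl⟩ := exists_mk A
  obtain ⟨n, hn⟩ := Superstructure.exists_level 𝓕
  obtain ⟨f, hf, hfR⟩ := hsat.exists_forall_eventually hκ h𝓕 n
    (fun j F y => y ∈ g j ∧ y ∈ F) (by
      intro T hT hne hT𝓕
      obtain ⟨F, hFT, x, hxA, hxF⟩ := h T hT hne hT𝓕
      obtain ⟨f, hf, rfl⟩ := exists_mk x
      refine ⟨f, fun W hW => ?_⟩
      filter_upwards [mk_mem_mk.1 (mem_elems.1 hxA), mk_mem_star.1 (mem_elems.1 hxF)] with j h1 h2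
      -- Members of members of `𝓕` are again of level `n`, so this one bound on `y` serves every
      -- `T`.
      have hWn : W ∈ level S (n + 1) := Superstructure.level_mono (Nat.le_succ n)
        (Superstructure.elems_subset_level (Superstructure.level_mono (Nat.le_succ n) hn)
          (hT𝓕 hW))
      exact ⟨Superstructure.elems_subset_level hWn (hFT W hW h2), h1, hFT W hW h2⟩)
  obtain ⟨F, hF⟩ := h𝓕
  exact ⟨mk U f hf, (hfR F hF).mono fun _ h => h.1,
    mem_monad.2 fun V hV => (hfR V hV).mono fun _ h => h.2⟩

/-- An internal set containing all `*`-finite subsets of `*X` that include `σX` contains `*F` for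
some finite `F ⊆ X`. -/
theorem exists_star_mem_of_forall_starFinite {κ : Cardinal.{u}} (hsat : IsSaturated S U κ)
    (hκ : Cardinal.lift.{u} (Cardinal.mk (Superstructure S)) < κ) {X : Superstructure S}
    {𝓑 : BoundedUltrapower S U}
    (h : ∀ E ∈ star U X.finiteSubsets, sigma U X ⊆ E.elems → E.elems ⊆ (star U X).elems → E ∈ 𝓑) :
    ∃ F ∈ X.finiteSubsets, star U F ∈ 𝓑 := by
  by_contra! hcon
  have subset_star : ∀ E ∈ star U X.finiteSubsets, E.elems ⊆ (star U X).elems := by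
    intro E hE
    obtain ⟨f, hf, rfl⟩ := exists_mk E
    exact elems_mk_subset (hg := ⟨_, (star U X).2.choose_spec⟩) ((mk_mem_star.1 hE).mono fun j h =>
      (Superstructure.mem_finiteSubsets.1 h).1.2)
  -- Saturation needs a nonempty index set; for empty `X` the standard set `*∅` already satisfies
  -- `h`.
  rcases X.elems.eq_empty_or_nonempty with hX | hX
  · obtain ⟨F, hF, -⟩ := Superstructure.exists_finiteSubsets_elems_eq finite_empty
      (empty_subset X.elems)
    refine hcon F hF (h _ (star_mem_star hF) ?_ (subset_star _ (star_mem_star hF)))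
    rw [sigma, hX, image_empty]
    exact empty_subset _
  obtain ⟨g, hg, rfl⟩ := exists_mk 𝓑
  obtain ⟨n, hn⟩ := X.finiteSubsets.exists_elems_subset_level
  obtain ⟨f, hf, hfR⟩ := hsat.exists_forall_eventually hκ hX n
    (fun j x y => y ∈ X.finiteSubsets ∧ y ∉ g j ∧ x ∈ y) (by
      intro T hT _ hTX
      obtain ⟨F, hF, rfl⟩ := Superstructure.exists_finiteSubsets_elems_eq hT hTX
      -- The finite set `T` itself, as the entity `F`, is the witness: `*F` avoids `𝓑` by `hcon`.
      refine ⟨fun _ => F, fun x hx => ?_⟩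
      have hF𝓑 : ∀ᶠ j in (U : Filter J), F ∉ g j :=
        Ultrafilter.eventually_not.2 fun hj => hcon F hF (star_mem_mk.2 hj)
      filter_upwards [hF𝓑] with j hj
      exact ⟨hn hF, hF, hj, hx⟩)
  obtain ⟨x, hx⟩ := hX
  have hfX : mk U f hf ∈ star U X.finiteSubsets := (hfR x hx).mono fun _ h => h.1
  refine Ultrafilter.eventually_not.1 ((hfR x hx).mono fun _ h => h.2.1)
    (mk_mem_mk.1 (h _ hfX ?_ (subset_star _ hfX)))
  rintro _ ⟨y, hy, rfl⟩
  exact (hfR y hy).mono fun _ h => h.2.2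

end BoundedUltrapower

theorem theorem6p7 {J : Type u} (U : Ultrafilter J) (κ : Cardinal.{u})
    (hκ : Cardinal.lift.{u} (Cardinal.mk (Superstructure ℝ)) < κ)
    (hsat : BoundedUltrapower.IsSaturated ℝ U κ) :
    -- an internal `Λ ⊆ *𝓑` that contains every `G ∈ *𝓑` with `G ⊆ μ_𝓑` contains a `*B`, `B ∈ 𝓑`
    (∀ X 𝓑 : Superstructure ℝ, X.IsFilterBase 𝓑 →
      ∀ Λ : BoundedUltrapower ℝ U, Λ.IsSet →
        Λ.elems ⊆ (BoundedUltrapower.star U 𝓑).elems →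
        (∀ G ∈ BoundedUltrapower.star U 𝓑, G.elems ⊆ BoundedUltrapower.monad U 𝓑 → G ∈ Λ) →
        ∃ B ∈ 𝓑, BoundedUltrapower.star U B ∈ Λ) ∧
    -- an internal `Λ ⊆ *𝓑` that contains `σ𝓑` has a member contained in `μ_𝓑`
    (∀ X 𝓑 : Superstructure ℝ, X.IsFilterBase 𝓑 →
      ∀ Λ : BoundedUltrapower ℝ U, Λ.IsSet →
        Λ.elems ⊆ (BoundedUltrapower.star U 𝓑).elems →
        BoundedUltrapower.sigma U 𝓑 ⊆ Λ.elems →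
        ∃ A ∈ Λ, A.IsSet ∧ A.elems ⊆ BoundedUltrapower.monad U 𝓑) ∧
    -- an internal set that meets `*F` for all `F ∈ ⟨𝓕⟩`, `𝓕` a filter subbase, meets `μ_𝓕`
    (∀ X 𝓕 : Superstructure ℝ, X.IsFilterSubbase 𝓕 →
      ∀ A : BoundedUltrapower ℝ U, A.IsSet →
        (∀ F : Superstructure ℝ, 𝓕.IsFiniteInter F →
          (A.elems ∩ (BoundedUltrapower.star U F).elems).Nonempty) →
        (A.elems ∩ BoundedUltrapower.monad U 𝓕).Nonempty) ∧
    -- an internal set that meets `*F` for all `F ∈ 𝓕`, `𝓕` a filter base, meets `μ_𝓕`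
    (∀ X 𝓕 : Superstructure ℝ, X.IsFilterBase 𝓕 →
      ∀ A : BoundedUltrapower ℝ U, A.IsSet →
        (∀ F ∈ 𝓕, (A.elems ∩ (BoundedUltrapower.star U F).elems).Nonempty) →
        (A.elems ∩ BoundedUltrapower.monad U 𝓕).Nonempty) ∧
    -- the version for `*`-finite sets
    (∀ X : Superstructure ℝ, X.IsSet →
      ∀ 𝓑 : BoundedUltrapower ℝ U, 𝓑.IsSet →
        𝓑.elems ⊆ (BoundedUltrapower.star U X.finiteSubsets).elems →
        (∀ E ∈ BoundedUltrapower.star U X.finiteSubsets,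
          BoundedUltrapower.sigma U X ⊆ E.elems →
          E.elems ⊆ (BoundedUltrapower.star U X).elems → E ∈ 𝓑) →
        ∃ F ∈ X.finiteSubsets, BoundedUltrapower.star U F ∈ 𝓑) := by
  refine ⟨fun X 𝓑 h𝓑 Λ _ _ h =>
      BoundedUltrapower.exists_star_mem_of_forall_subset_monad hsat hκ h𝓑 h,
    fun X 𝓑 h𝓑 Λ _ hΛ hσ => BoundedUltrapower.exists_mem_subset_monad hsat hκ h𝓑 hΛ hσ,
    fun X 𝓕 h𝓕 A _ h => BoundedUltrapower.inter_monad_nonempty hsat hκ h𝓕.nonempty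
      fun T hT hne hT𝓕 => ?_,
    fun X 𝓕 h𝓕 A _ h => BoundedUltrapower.inter_monad_nonempty hsat hκ h𝓕.nonempty
      fun T hT _ hT𝓕 => ?_,
    fun X _ 𝓑 _ _ h => BoundedUltrapower.exists_star_mem_of_forall_starFinite hsat hκ h⟩
  -- Below a finite `T` lies its intersection, for a subbase, and a single member, for a base.
  · obtain ⟨F, hF, hFT⟩ := Superstructure.exists_isFiniteInter hT hne hT𝓕
    exact ⟨F, fun W hW => hFT.subset.trans (biInter_subset_of_mem hW), h F hF⟩
  · obtain ⟨C, hC, hCT⟩ := h𝓕.exists_subset_of_finite hT hT𝓕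
    exact ⟨C, hCT, h C hC⟩
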